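/- Let $G=\mathrm U(3)$, let $H=\mathrm U(1)^3$ be the subgroup of diagonal matrices, and let $W^6=G/H$ with base point $o=eH$. Put $B(X,Y)=-\operatorname{tr}(XY)$ on $\mathfrak u(3)$, let $\mathfrak h$ be the Lie algebra of $H$, $\mathfrak m=\mathfrak h^{\perp}$ its $B$-orthogonal complement in $\mathfrak u(3)$, and write $Z_{\mathfrak m}$ for the component of $Z\in\mathfrak u(3)=\mathfrak h\oplus\mathfrak m$ in $\mathfrak m$. For $1\le i<j\le 3$ let $e_{ij}=E_{ij}-E_{ji}$, $f_{ij}=\sqrt{-1}\,(E_{ij}+E_{ji})$ and $\mathfrak m_{ij}=\operatorname{span}_{\mathbb R}\{e_{ij},f_{ij}\}$, so that $\mathfrak m=\mathfrak m_{12}\oplus\mathfrak m_{13}\oplus\mathfrak m_{23}$. The $G$-invariant Riemannian metrics on $W^6$ are identified with the linear operators $\Lambda:\mathfrak m\to\mathfrak m$ that are $B$-symmetric, positive definite and $\mathrm{Ad}(H)$-equivariant, through $\langle X,Y\rangle=B(\Lambda X,Y)$ on $\mathfrak m\cong T_oW^6$. A vector $X\in\mathfrak m$ is called an equigeodesic vector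 if the curve $t\mapsto \exp(tX)\cdot o$ is a geodesic (constant geodesics allowed) for every $G$-invariant metric on $W^6$. (1) Let $X=\sum_{1\le i<j\le 3}(a_{ij}e_{ij}+b_{ij}f_{ij})$ with $a_{ij},b_{ij}\in\mathbb R$. Then $[X,\Lambda X]_{\mathfrak m}=0$ for every invariant metric $\Lambda$ if and only if $$\begin{array}{ll} b_{12}b_{13}+a_{12}a_{13}=0, & b_{12}a_{13}-a_{12}b_{13}=0,\\ a_{12}a_{23}-b_{12}b_{23}=0, & a_{12}b_{23}+b_{12}a_{23}=0,\\ a_{13}a_{23}+b_{13}b_{23}=0, & a_{13}b_{23}-b_{13}a_{23}=0. \end{array}$$ This system holds if and only if $X$ lies in one of $\mathfrak m_{12},\mathfrak m_{13},\mathfrak m_{23}$. (2) A vector $X\in\mathfrak m$ is an equigeodesic vector if and only if it is trivial, that is, $X\in\mathfrak m_{12}$ or $X\in\mathfrak m_{13}$ or $X\in\mathfrak m_{23}$. -/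

import Mathlib

open scoped ContDiff

namespace WallachW6

/-- Complex `3 × 3` matrices. -/
abbrev Mat : Type := Matrix (Fin 3) (Fin 3) ℂ

/-- The group `G = U(3)`. -/
abbrev U3 : Type := Matrix.unitaryGroup (Fin 3) ℂ

/-- The subgroup `H = U(1)³` of `U(3)`, embedded as the diagonal unitary matrices. -/
def H : Subgroup U3 where
  carrier := {g | (g : Mat).IsDiag}
  one_mem' := Matrix.isDiag_one
  mul_mem' := by
    intro g h hg hh i j hij
    change ((g : Mat) * (h : Mat)) i j = 0
    rw [Matrix.mul_apply]
    refine Finset.sum_eq_zero fun k _ => ?_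
    by_cases hik : i = k
    · subst hik
      rw [hh hij, mul_zero]
    · rw [hg hik, zero_mul]
  inv_mem' := by
    intro g hg
    exact Matrix.IsDiag.conjTranspose hg

/-- The Wallach space `W⁶ = U(3)/U(1)³`. -/
abbrev W6 : Type := U3 ⧸ H

/-- The Lie algebra `𝔤 = 𝔲(3)` of skew-Hermitian matrices. -/
def 𝔤 : Submodule ℝ Mat where
  carrier := {X | X.conjTranspose = -X}
  zero_mem' := by simp
  add_mem' := by
    intro X Y hX hY
    simp only [Set.mem_ofPred_eq] at hX hY ⊢
    rw [Matrix.conjTranspose_add, hX, hY, neg_add]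
  smul_mem' := by
    intro r X hX
    simp only [Set.mem_ofPred_eq] at hX ⊢
    rw [Matrix.conjTranspose_smul, hX]
    simp

/-- The Lie algebra `𝔥 = 𝔲(1) ⊕ 𝔲(1) ⊕ 𝔲(1)` of `H`: diagonal skew-Hermitian matrices. -/
def 𝔥 : Submodule ℝ Mat where
  carrier := {X | X ∈ 𝔤 ∧ X.IsDiag}
  zero_mem' := ⟨𝔤.zero_mem, Matrix.isDiag_zero⟩
  add_mem' := fun hX hY => ⟨𝔤.add_mem hX.1 hY.1, hX.2.add hY.2⟩
  smul_mem' := fun r _ hX => ⟨𝔤.smul_mem r hX.1, hX.2.smul r⟩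

/-- `B(X, Y) = -tr(XY)`, as a real number (the trace is real for `X, Y ∈ 𝔲(3)`). -/
def B (X Y : Mat) : ℝ := -(X * Y).trace.re

/-- `𝔪 = 𝔥^⊥`, the `B`-orthogonal complement of `𝔥` in `𝔤`. -/
def 𝔪 : Submodule ℝ Mat where
  carrier := {X | X ∈ 𝔤 ∧ ∀ Z ∈ 𝔥, B X Z = 0}
  zero_mem' := ⟨𝔤.zero_mem, fun Z _ => by simp [B]⟩
  add_mem' := by
    rintro X Y ⟨hX, hX'⟩ ⟨hY, hY'⟩
    refine ⟨𝔤.add_mem hX hY, fun Z hZ => ?_⟩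
    have h1 := hX' Z hZ
    have h2 := hY' Z hZ
    simp only [B, add_mul, Matrix.trace_add, Complex.add_re] at h1 h2 ⊢
    linarith
  smul_mem' := by
    rintro r X ⟨hX, hX'⟩
    refine ⟨𝔤.smul_mem r hX, fun Z hZ => ?_⟩
    have h1 := hX' Z hZ
    simp only [B, Matrix.smul_mul, Matrix.trace_smul, Complex.smul_re, smul_eq_mul] at h1 ⊢
    rw [← mul_neg, h1, mul_zero]

/-- `e_ij = E_ij - E_ji`. -/
def e (i j : Fin 3) : Mat := Matrix.single i j 1 - Matrix.single j i 1

/-- `f_ij = √-1 (E_ij + E_ji)`. -/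
noncomputable def f (i j : Fin 3) : Mat := Complex.I • (Matrix.single i j 1 + Matrix.single j i 1)

/-- `𝔪_ij = span_ℝ {e_ij, f_ij}`. -/
noncomputable def 𝔪_ (i j : Fin 3) : Submodule ℝ Mat := Submodule.span ℝ {e i j, f i j}

theorem mem_𝔤 {X : Mat} : X ∈ 𝔤 ↔ X.conjTranspose = -X := Iff.rfl

/-- `𝔪` consists of the skew-Hermitian matrices with zero diagonal. -/
theorem mem_𝔪_iff {X : Mat} : X ∈ 𝔪 ↔ X ∈ 𝔤 ∧ ∀ i, X i i = 0 := by
  constructor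
  · rintro ⟨hX, h⟩
    refine ⟨hX, fun i => ?_⟩
    have hre : (X i i).re = 0 := by
      have h1 := congrArg Complex.re (congrFun (congrFun (mem_𝔤.1 hX) i) i)
      simp only [Matrix.conjTranspose_apply, Matrix.neg_apply, Complex.neg_re, RCLike.star_def,
        Complex.conj_re] at h1
      linarith
    have hD : Matrix.diagonal (Pi.single i Complex.I) ∈ 𝔥 := by
      refine ⟨?_, Matrix.isDiag_diagonal _⟩
      rw [mem_𝔤, Matrix.diagonal_conjTranspose, Matrix.diagonal_neg]
      congr 1
      funext k
      by_cases hk : k = i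
      · subst hk; simp
      · simp [hk]
    have h2 := h _ hD
    have him : (X i i).im = 0 := by
      simpa [B, Matrix.trace, Matrix.diag, Matrix.mul_diagonal, Pi.single_apply] using h2
    exact Complex.ext hre him
  · rintro ⟨hX, h⟩
    refine ⟨hX, fun Z hZ => ?_⟩
    have hz : (X * Z).trace = 0 := by
      refine Finset.sum_eq_zero fun i _ => ?_
      rw [Matrix.diag_apply, Matrix.mul_apply]
      refine Finset.sum_eq_zero fun k _ => ?_
      by_cases hk : k = i
      · subst hk; rw [h, zero_mul]
      · rw [hZ.2 hk, mul_zero]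
    simp [B, hz]

/-- The projection `X ↦ X_𝔪`. On `𝔤` it is the projection onto `𝔪` along `𝔥`
(see `proj_of_mem_𝔪`, `proj_of_mem_𝔥`, `sub_proj_mem_𝔥`); to have a map defined on all matrices,
the skew-Hermitian part is taken first, which changes nothing on `𝔤`. -/
noncomputable def proj : Mat →ₗ[ℝ] 𝔪 where
  toFun X := ⟨Matrix.of fun i j => if i = j then 0 else (X i j - star (X j i)) / 2, by
    rw [mem_𝔪_iff]
    refine ⟨?_, fun i => by simp⟩
    rw [mem_𝔤]
    ext i j
    by_cases hij : i = j
    · subst hij; simp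
    · simp only [Matrix.conjTranspose_apply, Matrix.of_apply, Matrix.neg_apply, if_neg hij,
        if_neg (Ne.symm hij)]
      simp
      ring⟩
  map_add' X Y := by
    ext i j
    by_cases hij : i = j
    · simp [hij]
    · simp [hij]
      ring
  map_smul' r X := by
    ext i j
    by_cases hij : i = j
    · simp [hij]
    · simp [hij]
      ring

theorem proj_apply {X : Mat} (hX : X ∈ 𝔤) (i j : Fin 3) :
    (proj X : Mat) i j = if i = j then 0 else X i j := by
  have h := congrFun (congrFun (mem_𝔤.1 hX) i) j
  simp only [Matrix.conjTranspose_apply, Matrix.neg_apply] at h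
  change (if i = j then (0 : ℂ) else (X i j - star (X j i)) / 2) = _
  rw [h]
  split_ifs
  · rfl
  · ring

theorem proj_of_mem_𝔪 (X : 𝔪) : proj (X : Mat) = X := by
  obtain ⟨h1, h2⟩ := mem_𝔪_iff.1 X.2
  ext i j
  rw [proj_apply h1]
  split_ifs with h
  · subst h; exact (h2 i).symm
  · rfl

theorem proj_of_mem_𝔥 {X : Mat} (hX : X ∈ 𝔥) : proj X = 0 := by
  ext i j
  rw [proj_apply hX.1]
  split_ifs with h
  · rfl
  · exact hX.2 h

theorem sub_proj_mem_𝔥 {X : Mat} (hX : X ∈ 𝔤) : X - (proj X : Mat) ∈ 𝔥 := by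
  refine ⟨𝔤.sub_mem hX (proj X).2.1, fun i j hij => ?_⟩
  change X i j - (proj X : Mat) i j = 0
  rw [proj_apply hX, if_neg hij, sub_self]

/-- The isotropy representation `Ad(h) X = h X h⁻¹` of `H` on `𝔪`. -/
def Ad (h : H) : 𝔪 →ₗ[ℝ] 𝔪 where
  toFun X := ⟨((h : U3) : Mat) * (X : Mat) * (((h : U3)⁻¹ : U3) : Mat), by
    obtain ⟨hX, hX'⟩ := mem_𝔪_iff.1 X.2
    have hd : ((h : U3) : Mat).IsDiag := h.2
    have hd' : (((h : U3)⁻¹ : U3) : Mat).IsDiag := H.inv_mem h.2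
    have hs : (((h : U3)⁻¹ : U3) : Mat) = ((h : U3) : Mat).conjTranspose := rfl
    rw [mem_𝔪_iff]
    constructor
    · rw [mem_𝔤, hs, Matrix.conjTranspose_mul, Matrix.conjTranspose_mul,
        Matrix.conjTranspose_conjTranspose, mem_𝔤.1 hX]
      simp [Matrix.mul_assoc]
    · intro i
      rw [Matrix.mul_apply]
      refine Finset.sum_eq_zero fun k _ => ?_
      by_cases hk : k = i
      · subst hk
        rw [Matrix.mul_apply, Finset.sum_eq_zero, zero_mul]
        intro l _
        by_cases hl : k = l
        · subst hl; rw [hX', mul_zero]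
        · rw [hd hl, zero_mul]
      · rw [hd' hk, mul_zero]⟩
  map_add' X Y := by
    ext1
    simp [mul_add, add_mul]
  map_smul' r X := by
    ext1
    simp

/-- A `U(3)`-invariant Riemannian metric on `W⁶`, given by its operator `Λ : 𝔪 → 𝔪`, which is
`B`-symmetric, positive definite and `Ad(H)`-equivariant; the inner product on `𝔪 = T_o W⁶` is
`⟨X, Y⟩ = B(Λ X, Y)`, and it is carried to the other points by the action of `U(3)`. -/
structure IsInvariantMetric (Λ : 𝔪 →ₗ[ℝ] 𝔪) : Prop where
  symm : ∀ X Y : 𝔪, B (Λ X) Y = B X (Λ Y)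
  pos : ∀ X : 𝔪, X ≠ 0 → 0 < B (Λ X) X
  equivariant : ∀ (h : H) (X : 𝔪), Λ (Ad h X) = Ad h (Λ X)

/-- Let `g` be a smooth curve in `U(3)`. The velocity at time `t` of the curve `g · o` in `W⁶`,
carried back to `T_o W⁶ = 𝔪` by the translation `g(t)⁻¹`, is `(g(t)⁻¹ g'(t))_𝔪`. -/
noncomputable def velocity (g : ℝ → U3) (t : ℝ) : 𝔪 :=
  proj ((((g t)⁻¹ : U3) : Mat) * Matrix.of fun i j => deriv (fun τ => (g τ : Mat) i j) t)

/-- The energy `½ ∫_a^b |γ'(t)|² dt`, in the invariant metric `Λ`, of the curve `γ = g · o` in `W⁶`.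
It depends on `γ` only: replacing `g` by `g h` with `h` a smooth curve in `H` changes the
velocity in `𝔪` by `Ad(h⁻¹)`, and the inner product is `Ad(H)`-invariant. -/
noncomputable def energy (Λ : 𝔪 →ₗ[ℝ] 𝔪) (g : ℝ → U3) (a b : ℝ) : ℝ :=
  (1 / 2) * ∫ t in a..b, B (Λ (velocity g t)) (velocity g t)

/-- Smooth maps into `U(3)`. -/
def SmoothToU3 {E : Type*} [NormedAddCommGroup E] [NormedSpace ℝ E] (g : E → U3) : Prop :=
  ∀ i j, ContDiff ℝ ∞ fun x => (g x : Mat) i j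

/-- `γ : ℝ → W⁶` is a geodesic of the invariant metric `Λ`: it is smooth and, on every interval
`[a, b]`, a critical point of the energy under smooth variations `(s, t) ↦ γ_s(t)` of `γ = γ_0`
which keep the endpoints `γ_s(a)`, `γ_s(b)` fixed. Smooth maps from `ℝ` or `ℝ × ℝ` to the
quotient `W⁶ = U(3)/H` are the maps `p ↦ g(p) · o` with `g` smooth into `U(3)`, because
principal `H`-bundles over `ℝ` and `ℝ × ℝ` have global smooth sections. -/
def IsGeodesic (Λ : 𝔪 →ₗ[ℝ] 𝔪) (γ : ℝ → W6) : Prop :=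
  (∃ g : ℝ → U3, SmoothToU3 g ∧ ∀ t, (g t : W6) = γ t) ∧
  ∀ a b : ℝ, a < b → ∀ c : ℝ × ℝ → U3, SmoothToU3 c →
    (∀ t, (c (0, t) : W6) = γ t) →
    (∀ s, (c (s, a) : W6) = γ a ∧ (c (s, b) : W6) = γ b) →
    HasDerivAt (fun s => energy Λ (fun t => c (s, t)) a b) 0 0

theorem exp_mem_unitaryGroup {X : Mat} (hX : X ∈ 𝔤) :
    NormedSpace.exp X ∈ Matrix.unitaryGroup (Fin 3) ℂ := by
  rw [Matrix.mem_unitaryGroup_iff, Matrix.star_eq_conjTranspose, ← Matrix.exp_conjTranspose,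
    mem_𝔤.1 hX, ← Matrix.exp_add_of_commute _ _ (Commute.neg_right (Commute.refl X)),
    add_neg_cancel, NormedSpace.exp_zero]

/-- The one-parameter subgroup `t ↦ exp(tX)` of `U(3)`. -/
noncomputable def expCurve (X : 𝔪) (t : ℝ) : U3 :=
  ⟨NormedSpace.exp (t • (X : Mat)), exp_mem_unitaryGroup (𝔤.smul_mem t X.2.1)⟩

/-- `X ∈ 𝔪` is an equigeodesic vector: the curve `t ↦ exp(tX) · o` in `W⁶` is a geodesic with
respect to every invariant metric. -/
def IsEquigeodesicVector (X : 𝔪) : Prop :=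
  ∀ Λ : 𝔪 →ₗ[ℝ] 𝔪, IsInvariantMetric Λ → IsGeodesic Λ fun t => (expCurve X t : W6)

/-- `X` is trivial: it lies in a single summand `𝔪_ij`, `i < j`. -/
def IsTrivial (X : 𝔪) : Prop :=
  ∃ i j : Fin 3, i < j ∧ (X : Mat) ∈ 𝔪_ i j

end WallachW6

open WallachW6

namespace WallachW6

/-! The problem reduces to the algebra of $[X,\Lambda X]$. For a variation $c(s,t)$ of $\exp(tX)$
with fixed endpoints in the quotient and $W=c^{-1}\partial_s c$, the Maurer–Cartan equation and one
integration by parts give the first variation of the energy as $\int B([\Lambda X,X],W)\,dt$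
(`hasDerivAt_energy`). So $[X,\Lambda X]=0$ makes the curve a geodesic, and a variation in the
direction $[\Lambda X,X]_{\mathfrak m}$ shows that a geodesic has $[X,\Lambda X]_{\mathfrak m}=0$.

Necessity of triviality needs a single metric: `weightOp` has the distinct eigenvalues 1, 2, 3 on
$\mathfrak m_{12},\mathfrak m_{13},\mathfrak m_{23}$. Each off-diagonal entry of the bracket is
then, up to conjugations, a nonzero multiple of a product of two of the entries $x=X_{01}$,
$y=X_{02}$, $z=X_{12}$, so at most one of these is nonzero.

Sufficiency is Schur's lemma: equivariance keeps $\Lambda X$ in the summand containing $X$, and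
symmetry forces it to be parallel to $X$ over $\mathbb R$ when $X\ne 0$. Thus the whole bracket
vanishes, not only its $\mathfrak m$-part.

The six real equations are the real and imaginary parts of $\bar x y=0$, $xz=0$, $\bar y z=0$. -/

/-! ### Algebra of 𝔪: a test metric, trivial vectors and Schur's lemma. -/

theorem apply_apply_of_mem_𝔤 {X : Mat} (hX : X ∈ 𝔤) (i j : Fin 3) : X i j = -star (X j i) := by
  have h := congrFun (congrFun (mem_𝔤.1 hX) i) j
  simp only [Matrix.conjTranspose_apply, Matrix.neg_apply] at h
  rw [h, neg_neg]

theorem lie_mem_𝔤 {X Y : Mat} (hX : X ∈ 𝔤) (hY : Y ∈ 𝔤) : ⁅X, Y⁆ ∈ 𝔤 := by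
  rw [mem_𝔤] at hX hY ⊢
  rw [Ring.lie_def, Matrix.conjTranspose_sub, Matrix.conjTranspose_mul, Matrix.conjTranspose_mul,
    hX, hY, neg_mul_neg, neg_mul_neg, neg_sub]

/-- The diagonal unitary matrix with given unimodular entries, as an element of `H`. -/
def diagH (d : Fin 3 → ℂ) (hd : ∀ i, d i * star (d i) = 1) : H :=
  ⟨⟨Matrix.diagonal d, by
    rw [Matrix.mem_unitaryGroup_iff, Matrix.star_eq_conjTranspose, Matrix.diagonal_conjTranspose,
      Matrix.diagonal_mul_diagonal, ← Matrix.diagonal_one]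
    congr 1
    funext i
    exact hd i⟩, Matrix.isDiag_diagonal d⟩

theorem Ad_diagH_apply (d : Fin 3 → ℂ) (hd : ∀ i, d i * star (d i) = 1) (X : 𝔪) (i j : Fin 3) :
    (Ad (diagH d hd) X : Mat) i j = d i * (X : Mat) i j * star (d j) := by
  change (Matrix.diagonal d * (X : Mat) * (Matrix.diagonal d).conjTranspose) i j = _
  rw [Matrix.diagonal_conjTranspose, Matrix.mul_diagonal, Matrix.diagonal_mul]
  rfl

/-- The form `B` on `𝔪`, in matrix entries. -/
theorem B_eq_sum (X Y : 𝔪) : B (X : Mat) Y = 2 * ((X : Mat) 0 1 * star ((Y : Mat) 0 1) +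
    (X : Mat) 0 2 * star ((Y : Mat) 0 2) + (X : Mat) 1 2 * star ((Y : Mat) 1 2)).re := by
  obtain ⟨hX, hX0⟩ := mem_𝔪_iff.1 X.2
  obtain ⟨hY, hY0⟩ := mem_𝔪_iff.1 Y.2
  simp only [B, Matrix.trace, Matrix.diag, Matrix.mul_apply, Fin.sum_univ_three, hX0]
  rw [apply_apply_of_mem_𝔤 hX 1 0, apply_apply_of_mem_𝔤 hX 2 0, apply_apply_of_mem_𝔤 hX 2 1,
    apply_apply_of_mem_𝔤 hY 1 0, apply_apply_of_mem_𝔤 hY 2 0, apply_apply_of_mem_𝔤 hY 2 1]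
  simp
  ring

theorem ext_𝔪 {X Y : 𝔪} (h01 : (X : Mat) 0 1 = (Y : Mat) 0 1) (h02 : (X : Mat) 0 2 = (Y : Mat) 0 2)
    (h12 : (X : Mat) 1 2 = (Y : Mat) 1 2) : X = Y := by
  obtain ⟨hX, hX0⟩ := mem_𝔪_iff.1 X.2
  obtain ⟨hY, hY0⟩ := mem_𝔪_iff.1 Y.2
  ext i j
  fin_cases i <;> fin_cases j <;>
    simp [hX0, hY0, h01, h02, h12, apply_apply_of_mem_𝔤 hX 1 0, apply_apply_of_mem_𝔤 hX 2 0,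
      apply_apply_of_mem_𝔤 hX 2 1, apply_apply_of_mem_𝔤 hY 1 0, apply_apply_of_mem_𝔤 hY 2 0,
      apply_apply_of_mem_𝔤 hY 2 1]

theorem eq_zero_of_B_self_eq_zero {X : 𝔪} (h : B (X : Mat) X = 0) : X = 0 := by
  rw [B_eq_sum] at h
  simp only [RCLike.star_def, Complex.mul_conj, Complex.add_re, Complex.ofReal_re] at h
  have h1 := Complex.normSq_nonneg ((X : Mat) 0 1)
  have h2 := Complex.normSq_nonneg ((X : Mat) 0 2)
  have h3 := Complex.normSq_nonneg ((X : Mat) 1 2)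
  exact ext_𝔪 (Complex.normSq_eq_zero.1 (by linarith)) (Complex.normSq_eq_zero.1 (by linarith))
    (Complex.normSq_eq_zero.1 (by linarith))

/-- The operator which multiplies the entries at `(i, j)` and `(j, i)` by `i + j`. -/
def weightOp : 𝔪 →ₗ[ℝ] 𝔪 where
  toFun X := ⟨Matrix.of fun i j => ((i : ℕ) + (j : ℕ) : ℂ) * (X : Mat) i j, by
    obtain ⟨hX, hX0⟩ := mem_𝔪_iff.1 X.2
    refine mem_𝔪_iff.2 ⟨?_, fun i => by simp [hX0]⟩
    rw [mem_𝔤]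
    ext i j
    simp [apply_apply_of_mem_𝔤 hX i j, add_comm]⟩
  map_add' X Y := by
    ext i j
    simp [mul_add]
  map_smul' r X := by
    ext i j
    simp [mul_left_comm]

theorem weightOp_apply (X : 𝔪) (i j : Fin 3) :
    (weightOp X : Mat) i j = ((i : ℕ) + (j : ℕ) : ℂ) * (X : Mat) i j := rfl

theorem isInvariantMetric_weightOp : IsInvariantMetric weightOp where
  symm X Y := by
    rw [B_eq_sum, B_eq_sum]
    simp [weightOp_apply]
    ring
  pos X hX := by
    -- All off-diagonal weights are at least 1, so $B(\Lambda X,X)\ge B(X,X)>0$.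
    refine lt_of_lt_of_le (b := B (X : Mat) X) (lt_of_le_of_ne ?_ fun h =>
      hX (eq_zero_of_B_self_eq_zero h.symm)) ?_ <;>
    · simp only [B_eq_sum, weightOp_apply, mul_assoc, RCLike.star_def, Complex.mul_conj]
      have h1 := Complex.normSq_nonneg ((X : Mat) 0 1)
      have h2 := Complex.normSq_nonneg ((X : Mat) 0 2)
      have h3 := Complex.normSq_nonneg ((X : Mat) 1 2)
      simp
      linarith
  equivariant h X := by
    have hh : ∀ (Y : 𝔪) (i j : Fin 3), (Ad h Y : Mat) i j =
        ((h : U3) : Mat) i i * (Y : Mat) i j * (((h : U3)⁻¹ : U3) : Mat) j j := by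
      intro Y i j
      have hd : ((h : U3) : Mat).IsDiag := h.2
      have hd' : (((h : U3)⁻¹ : U3) : Mat).IsDiag := H.inv_mem h.2
      change (((h : U3) : Mat) * (Y : Mat) * (((h : U3)⁻¹ : U3) : Mat)) i j = _
      rw [Matrix.mul_apply, Finset.sum_eq_single j, Matrix.mul_apply, Finset.sum_eq_single i]
      · intro k _ hk
        rw [hd (Ne.symm hk), zero_mul]
      · simp
      · intro k _ hk
        rw [hd' hk, mul_zero]
      · simp
    ext i j
    rw [weightOp_apply, hh, hh, weightOp_apply]
    ring

/-- `X` is trivial if and only if at most one of its entries above the diagonal is nonzero. -/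
theorem isTrivial_iff (X : 𝔪) : IsTrivial X ↔
    ((X : Mat) 0 1 * (X : Mat) 1 2 = 0 ∧ (X : Mat) 0 1 * (X : Mat) 0 2 = 0 ∧
      (X : Mat) 0 2 * (X : Mat) 1 2 = 0) := by
  constructor
  · rintro ⟨i, j, hij, h⟩
    obtain ⟨a, b, h⟩ := Submodule.mem_span_pair.1 h
    rw [← h]
    fin_cases i <;> fin_cases j <;> simp at hij <;> simp [e, f, Matrix.single]
  · intro h
    obtain ⟨hX, hX0⟩ := mem_𝔪_iff.1 X.2
    have h3 : ((X : Mat) 0 2 = 0 ∧ (X : Mat) 1 2 = 0) ∨ ((X : Mat) 0 1 = 0 ∧ (X : Mat) 1 2 = 0) ∨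
        ((X : Mat) 0 1 = 0 ∧ (X : Mat) 0 2 = 0) := by
      simp only [mul_eq_zero] at h
      tauto
    obtain ⟨h1, h2⟩ | ⟨h1, h2⟩ | ⟨h1, h2⟩ := h3
    · refine ⟨0, 1, by decide, Submodule.mem_span_pair.2
        ⟨((X : Mat) 0 1).re, ((X : Mat) 0 1).im, ?_⟩⟩
      ext i j
      fin_cases i <;> fin_cases j <;> simp [e, f, Matrix.single, hX0, h1, h2,
        apply_apply_of_mem_𝔤 hX 1 0, apply_apply_of_mem_𝔤 hX 2 0, apply_apply_of_mem_𝔤 hX 2 1,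
        Complex.ext_iff]
    · refine ⟨0, 2, by decide, Submodule.mem_span_pair.2
        ⟨((X : Mat) 0 2).re, ((X : Mat) 0 2).im, ?_⟩⟩
      ext i j
      fin_cases i <;> fin_cases j <;> simp [e, f, Matrix.single, hX0, h1, h2,
        apply_apply_of_mem_𝔤 hX 1 0, apply_apply_of_mem_𝔤 hX 2 0, apply_apply_of_mem_𝔤 hX 2 1,
        Complex.ext_iff]
    · refine ⟨1, 2, by decide, Submodule.mem_span_pair.2
        ⟨((X : Mat) 1 2).re, ((X : Mat) 1 2).im, ?_⟩⟩
      ext i j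
      fin_cases i <;> fin_cases j <;> simp [e, f, Matrix.single, hX0, h1, h2,
        apply_apply_of_mem_𝔤 hX 1 0, apply_apply_of_mem_𝔤 hX 2 0, apply_apply_of_mem_𝔤 hX 2 1,
        Complex.ext_iff]

/-- The $(i,j)$ entry of the bracket is $X_{ik}X_{kj}$ times the difference of the weights of the
pairs $\{k,j\}$ and $\{i,k\}$, where $k$ is the third index; the weights are distinct, so the
product vanishes. -/
theorem isTrivial_of_proj_lie_weightOp_eq_zero {X : 𝔪}
    (h : proj ⁅(X : Mat), (weightOp X : Mat)⁆ = 0) : IsTrivial X := by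
  obtain ⟨hX, hX0⟩ := mem_𝔪_iff.1 X.2
  have hij : ∀ i j, i ≠ j → ⁅(X : Mat), (weightOp X : Mat)⁆ i j = 0 := by
    intro i j hij
    have := proj_apply (lie_mem_𝔤 hX (weightOp X).2.1) i j
    rw [if_neg hij] at this
    rw [← this, h]
    rfl
  have h01 := hij 0 1 (by decide)
  have h02 := hij 0 2 (by decide)
  have h12 := hij 1 2 (by decide)
  rw [isTrivial_iff]
  simp only [Ring.lie_def, Matrix.sub_apply, Matrix.mul_apply, Fin.sum_univ_three, weightOp_apply,
    hX0, apply_apply_of_mem_𝔤 hX 1 0, apply_apply_of_mem_𝔤 hX 2 1] at h01 h02 h12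
  simp at h01 h02 h12
  refine ⟨?_, ?_, ?_⟩
  · linear_combination (1 / 2) * h02
  · have : star ((X : Mat) 0 1) * (X : Mat) 0 2 = 0 := by
      simp only [RCLike.star_def]
      linear_combination -h12
    rw [mul_eq_zero, star_eq_zero] at this
    rwa [mul_eq_zero]
  · have : (X : Mat) 0 2 * star ((X : Mat) 1 2) = 0 := by
      simp only [RCLike.star_def]
      linear_combination - h01
    rw [mul_eq_zero, star_eq_zero] at this
    rwa [mul_eq_zero]

/-- Schur's lemma for the isotropy representation, in the form needed here. -/
theorem IsInvariantMetric.lie_eq_zero {Λ : 𝔪 →ₗ[ℝ] 𝔪} (hΛ : IsInvariantMetric Λ) {X : 𝔪}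
    (hX : IsTrivial X) : ⁅(X : Mat), (Λ X : Mat)⁆ = 0 := by
  -- An element of $H$ fixing $X$ also fixes $\Lambda X$. With one sign $-1$ chosen to fix the
  -- summand of $X$, this kills the entries of $\Lambda X$ in the other two summands.
  have reflect : ∀ (d : Fin 3 → ℂ) (hd : ∀ i, d i * star (d i) = 1), Ad (diagH d hd) X = X →
      ∀ i j, d i * (Λ X : Mat) i j * star (d j) = (Λ X : Mat) i j := by
    intro d hd h i j
    rw [← Ad_diagH_apply d hd, ← hΛ.equivariant, h]
  -- Taking $d$ so that `Ad` multiplies the remaining entry $x$ by $\sqrt{-1}$, and writing $u$ for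
  -- that entry of $\Lambda X$, this identity says $\operatorname{Im}(u\bar x)=0$. That is the
  -- vanishing of the diagonal of the bracket.
  have rotate : ∀ (d : Fin 3 → ℂ) (hd : ∀ i, d i * star (d i) = 1),
      B (Λ X) (Ad (diagH d hd) X) = B X (Ad (diagH d hd) (Λ X)) := by
    intro d hd
    rw [← hΛ.equivariant, hΛ.symm]
  obtain ⟨mX, mX0⟩ := mem_𝔪_iff.1 X.2
  obtain ⟨mY, mY0⟩ := mem_𝔪_iff.1 (Λ X).2
  have h3 : ((X : Mat) 0 2 = 0 ∧ (X : Mat) 1 2 = 0) ∨ ((X : Mat) 0 1 = 0 ∧ (X : Mat) 1 2 = 0) ∨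
      ((X : Mat) 0 1 = 0 ∧ (X : Mat) 0 2 = 0) := by
    have := (isTrivial_iff X).1 hX
    simp only [mul_eq_zero] at this
    tauto
  obtain ⟨h1, h2⟩ | ⟨h1, h2⟩ | ⟨h1, h2⟩ := h3
  · have hr := reflect ![1, 1, -1] (by intro i; fin_cases i <;> simp)
      (by apply ext_𝔪 <;> rw [Ad_diagH_apply] <;> simp [h1, h2])
    have r1 := hr 0 2
    have r2 := hr 1 2
    have r3 := rotate ![Complex.I, 1, 1] (by intro i; fin_cases i <;> simp)
    simp [neg_eq_self] at r1 r2
    simp only [B_eq_sum, Ad_diagH_apply] at r3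
    simp [h1, h2, r1, r2] at r3
    ext i j
    fin_cases i <;> fin_cases j <;> simp [Ring.lie_def, Matrix.mul_apply, Fin.sum_univ_three,
      mX0, mY0, h1, h2, r1, r2, apply_apply_of_mem_𝔤 mX 1 0, apply_apply_of_mem_𝔤 mX 2 0,
      apply_apply_of_mem_𝔤 mX 2 1, apply_apply_of_mem_𝔤 mY 1 0, apply_apply_of_mem_𝔤 mY 2 0,
      apply_apply_of_mem_𝔤 mY 2 1, Complex.ext_iff] <;> constructor <;> linarith
  · have hr := reflect ![1, -1, 1] (by intro i; fin_cases i <;> simp)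
      (by apply ext_𝔪 <;> rw [Ad_diagH_apply] <;> simp [h1, h2])
    have r1 := hr 0 1
    have r2 := hr 1 2
    have r3 := rotate ![Complex.I, 1, 1] (by intro i; fin_cases i <;> simp)
    simp [neg_eq_self] at r1 r2
    simp only [B_eq_sum, Ad_diagH_apply] at r3
    simp [h1, h2, r1, r2] at r3
    ext i j
    fin_cases i <;> fin_cases j <;> simp [Ring.lie_def, Matrix.mul_apply, Fin.sum_univ_three,
      mX0, mY0, h1, h2, r1, r2, apply_apply_of_mem_𝔤 mX 1 0, apply_apply_of_mem_𝔤 mX 2 0,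
      apply_apply_of_mem_𝔤 mX 2 1, apply_apply_of_mem_𝔤 mY 1 0, apply_apply_of_mem_𝔤 mY 2 0,
      apply_apply_of_mem_𝔤 mY 2 1, Complex.ext_iff] <;> constructor <;> linarith
  · have hr := reflect ![-1, 1, 1] (by intro i; fin_cases i <;> simp)
      (by apply ext_𝔪 <;> rw [Ad_diagH_apply] <;> simp [h1, h2])
    have r1 := hr 0 1
    have r2 := hr 0 2
    have r3 := rotate ![1, Complex.I, 1] (by intro i; fin_cases i <;> simp)
    simp [neg_eq_self] at r1 r2
    simp only [B_eq_sum, Ad_diagH_apply] at r3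
    simp [h1, h2, r1, r2] at r3
    ext i j
    fin_cases i <;> fin_cases j <;> simp [Ring.lie_def, Matrix.mul_apply, Fin.sum_univ_three,
      mX0, mY0, h1, h2, r1, r2, apply_apply_of_mem_𝔤 mX 1 0, apply_apply_of_mem_𝔤 mX 2 0,
      apply_apply_of_mem_𝔤 mX 2 1, apply_apply_of_mem_𝔤 mY 1 0, apply_apply_of_mem_𝔤 mY 2 0,
      apply_apply_of_mem_𝔤 mY 2 1, Complex.ext_iff] <;> constructor <;> linarith

/-! ### Logarithmic derivatives and the first variation in a normed ring. -/

section NormedRing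

/-- Differentiation under the integral sign for `C¹` integrands. -/
theorem hasDerivAt_intervalIntegral_of_contDiff {F : ℝ × ℝ → ℝ} (hF : ContDiff ℝ 1 F) {a b : ℝ} :
    HasDerivAt (fun s => ∫ t in a..b, F (s, t)) (∫ t in a..b, fderiv ℝ F (0, t) (1, 0)) 0 := by
  have hc : Continuous fun p : ℝ × ℝ => fderiv ℝ F p (1, 0) :=
    (hF.continuous_fderiv one_ne_zero).clm_apply continuous_const
  -- A compact neighbourhood of $s=0$ gives a constant as dominating function.
  obtain ⟨K, hK⟩ := ((isCompact_Icc (a := (-1 : ℝ)) (b := 1)).prod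
    (isCompact_uIcc (a := a) (b := b))).exists_bound_of_continuousOn hc.continuousOn
  refine (intervalIntegral.hasDerivAt_integral_of_dominated_loc_of_deriv_le
    (F := fun s t => F (s, t)) (F' := fun s t => fderiv ℝ F (s, t) (1, 0)) (bound := fun _ => K)
    (Icc_mem_nhds (a := (-1 : ℝ)) (b := 1) (by norm_num) (by norm_num)) ?_ ?_ ?_ ?_ ?_ ?_).2
  · refine Filter.Eventually.of_forall fun s => ?_
    exact (hF.continuous.comp (Continuous.prodMk_right s)).aestronglyMeasurable
  · exact (hF.continuous.comp (Continuous.prodMk_right 0)).intervalIntegrable _ _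
  · exact (hc.comp (Continuous.prodMk_right 0)).aestronglyMeasurable
  · refine Filter.Eventually.of_forall fun t ht s hs => ?_
    exact hK (s, t) ⟨hs, Set.uIoc_subset_uIcc ht⟩
  · exact intervalIntegrable_const
  · refine Filter.Eventually.of_forall fun t _ s _ => ?_
    exact (hF.differentiable one_ne_zero (s, t)).hasFDerivAt.comp_hasDerivAt s
      ((hasDerivAt_id s).prodMk (hasDerivAt_const s t))

theorem hasDerivAt_slice_left {E : Type*} [NormedAddCommGroup E] [NormedSpace ℝ E]
    {F : ℝ × ℝ → E} (hF : Differentiable ℝ F) (s t : ℝ) :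
    HasDerivAt (fun σ => F (σ, t)) (fderiv ℝ F (s, t) (1, 0)) s :=
  (hF (s, t)).hasFDerivAt.comp_hasDerivAt s ((hasDerivAt_id s).prodMk (hasDerivAt_const s t))

theorem hasDerivAt_slice_right {E : Type*} [NormedAddCommGroup E] [NormedSpace ℝ E]
    {F : ℝ × ℝ → E} (hF : Differentiable ℝ F) (s t : ℝ) :
    HasDerivAt (fun τ => F (s, τ)) (fderiv ℝ F (s, t) (0, 1)) t :=
  (hF (s, t)).hasFDerivAt.comp_hasDerivAt t ((hasDerivAt_const t s).prodMk (hasDerivAt_id t))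

theorem hasDerivAt_line {E : Type*} [NormedAddCommGroup E] [NormedSpace ℝ E]
    {F : ℝ × ℝ → E} {p : ℝ × ℝ} (hF : DifferentiableAt ℝ F p) (v : ℝ × ℝ) :
    HasDerivAt (fun τ : ℝ => F (p + τ • v)) (fderiv ℝ F p v) 0 := by
  have h1 : HasDerivAt (fun τ : ℝ => p + τ • v) v 0 := by
    simpa using ((hasDerivAt_id (0 : ℝ)).smul_const v).const_add p
  have e : p + (0 : ℝ) • v = p := by simp
  have h2 : HasFDerivAt F (fderiv ℝ F p) (p + (0 : ℝ) • v) := by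
    rw [e]
    exact hF.hasFDerivAt
  exact h2.comp_hasDerivAt 0 h1

variable {𝔸 : Type*} [NormedRing 𝔸] [NormedAlgebra ℝ 𝔸] {C D : ℝ × ℝ → 𝔸}

/-- The logarithmic derivative `D ∂_v C` of a map `C` with inverse `D`. -/
noncomputable def leftLogDeriv (C D : ℝ × ℝ → 𝔸) (v p : ℝ × ℝ) : 𝔸 := D p * fderiv ℝ C p v

theorem contDiff_leftLogDeriv (hC : ContDiff ℝ ∞ C) (hD : ContDiff ℝ ∞ D) (v : ℝ × ℝ) :
    ContDiff ℝ ∞ (leftLogDeriv C D v) :=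
  hD.mul ((hC.fderiv_right (m := ∞) le_rfl).clm_apply contDiff_const)

theorem leftLogDeriv_fst (hC : ContDiff ℝ ∞ C) {s t : ℝ} {C' : 𝔸}
    (h : HasDerivAt (fun σ => C (σ, t)) C' s) : leftLogDeriv C D (1, 0) (s, t) = D (s, t) * C' := by
  rw [leftLogDeriv, (hasDerivAt_slice_left (hC.differentiable (by simp)) s t).unique h]

theorem leftLogDeriv_snd (hC : ContDiff ℝ ∞ C) {s t : ℝ} {C' : 𝔸}
    (h : HasDerivAt (fun τ => C (s, τ)) C' t) : leftLogDeriv C D (0, 1) (s, t) = D (s, t) * C' := by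
  rw [leftLogDeriv, (hasDerivAt_slice_right (hC.differentiable (by simp)) s t).unique h]

/-- Product rule together with $\partial_w D=-D(\partial_w C)D$. Only the last term fails to be
symmetric in $v,w$, which is the source of the bracket in the Maurer–Cartan equation. -/
theorem fderiv_leftLogDeriv (hC : ContDiff ℝ ∞ C) (hD : ContDiff ℝ ∞ D) (hDC : ∀ p, D p * C p = 1)
    (hCD : ∀ p, C p * D p = 1) (v w p : ℝ × ℝ) :
    fderiv ℝ (leftLogDeriv C D v) p w =
      D p * fderiv ℝ (fderiv ℝ C) p w v - leftLogDeriv C D w p * leftLogDeriv C D v p := by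
  have hC' : ContDiff ℝ ∞ (fderiv ℝ C) := hC.fderiv_right (m := ∞) le_rfl
  have hd := hasDerivAt_line (hD.differentiable (by simp) p) w
  have h0 := hd.mul (hasDerivAt_line (hC.differentiable (by simp) p) w)
  have h2 := (hasDerivAt_line (hC'.differentiable (by simp) p) w).clm_apply
    (hasDerivAt_const (0 : ℝ) v)
  have h3 := hasDerivAt_line ((contDiff_leftLogDeriv hC hD v).differentiable (by simp) p) w
  have h4 := h3.unique (hd.mul h2)
  have e : p + (0 : ℝ) • w = p := by simp
  have h5 : ((fun τ : ℝ => D (p + τ • w)) * fun τ : ℝ => C (p + τ • w)) = fun _ => 1 :=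
    funext fun τ => hDC _
  rw [h5] at h0
  have h6 := h0.unique (hasDerivAt_const 0 1)
  simp only [e] at h6 h4
  have h7 : fderiv ℝ D p w = -(D p * fderiv ℝ C p w * D p) := by
    have := congrArg (· * D p) h6
    simp only [add_mul, mul_assoc, hCD, mul_one, zero_mul] at this
    rw [eq_neg_of_add_eq_zero_left this, mul_assoc]
  rw [h4, h7]
  simp only [map_zero, add_zero, leftLogDeriv]
  noncomm_ring

/-- The Maurer–Cartan equation. -/
theorem fderiv_leftLogDeriv_comm (hC : ContDiff ℝ ∞ C) (hD : ContDiff ℝ ∞ D)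
    (hDC : ∀ p, D p * C p = 1) (hCD : ∀ p, C p * D p = 1) (v w p : ℝ × ℝ) :
    fderiv ℝ (leftLogDeriv C D v) p w = fderiv ℝ (leftLogDeriv C D w) p v +
      ⁅leftLogDeriv C D v p, leftLogDeriv C D w p⁆ := by
  have h2 : (2 : WithTop ℕ∞) ≤ ∞ := WithTop.coe_le_coe.2 (le_top : (2 : ℕ∞) ≤ ⊤)
  have hs : IsSymmSndFDerivAt ℝ C p := hC.contDiffAt.isSymmSndFDerivAt (by simpa using h2)
  rw [fderiv_leftLogDeriv hC hD hDC hCD, fderiv_leftLogDeriv hC hD hDC hCD, hs.eq v w, Ring.lie_def]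
  abel

/-- The first variation of the energy, for the quadratic form `M ↦ τ (L M * P M)` in the logarithmic
derivative, at a curve with constant logarithmic derivative `X`. -/
theorem hasDerivAt_quadratic_energy (hC : ContDiff ℝ ∞ C) (hD : ContDiff ℝ ∞ D)
    (hDC : ∀ p, D p * C p = 1) (hCD : ∀ p, C p * D p = 1) (L P : 𝔸 →L[ℝ] 𝔸) (τ : 𝔸 →L[ℝ] ℝ)
    (hτ : ∀ M N, τ (M * N) = τ (N * M)) {X Y : 𝔸}
    (hX : ∀ t, leftLogDeriv C D (0, 1) (0, t) = X)
    (hY : ∀ M, τ (L M * P X + L X * P M) = 2 * τ (Y * M)) {a b : ℝ}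
    (ha : τ (Y * leftLogDeriv C D (1, 0) (0, a)) = 0)
    (hb : τ (Y * leftLogDeriv C D (1, 0) (0, b)) = 0) :
    HasDerivAt (fun s => (1 / 2 : ℝ) * ∫ t in a..b,
        τ (L (leftLogDeriv C D (0, 1) (s, t)) * P (leftLogDeriv C D (0, 1) (s, t))))
      (∫ t in a..b, τ (⁅Y, X⁆ * leftLogDeriv C D (1, 0) (0, t))) 0 := by
  set U := leftLogDeriv C D (0, 1) with hU
  set W := leftLogDeriv C D (1, 0) with hW
  have hUs : ContDiff ℝ ∞ U := contDiff_leftLogDeriv hC hD _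
  have hWs : ContDiff ℝ ∞ W := contDiff_leftLogDeriv hC hD _
  let F : ℝ × ℝ → ℝ := fun p => τ (L (U p) * P (U p))
  have hF : ContDiff ℝ ∞ F := τ.contDiff.comp ((L.contDiff.comp hUs).mul (P.contDiff.comp hUs))
  have hF' : ∀ t, fderiv ℝ F (0, t) (1, 0) = 2 * τ (Y * fderiv ℝ U (0, t) (1, 0)) := by
    intro t
    have hUd := hasDerivAt_slice_left (hUs.differentiable (by simp)) 0 t
    have h1 := hasDerivAt_slice_left (hF.differentiable (by simp)) 0 t
    have h2 := τ.hasFDerivAt.comp_hasDerivAt 0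
      ((L.hasFDerivAt.comp_hasDerivAt 0 hUd).mul (P.hasFDerivAt.comp_hasDerivAt 0 hUd))
    rw [h1.unique h2, ← hY]
    simp only [Function.comp_apply, hX]
  have hg : ∀ t, HasDerivAt (fun t => τ (Y * W (0, t))) (τ (Y * fderiv ℝ W (0, t) (0, 1))) t :=
    fun t => τ.hasFDerivAt.comp_hasDerivAt t
      ((hasDerivAt_slice_right (hWs.differentiable (by simp)) 0 t).const_mul Y)
  have hτc : ∀ (Z : 𝔸) {f : ℝ → 𝔸}, Continuous f → Continuous fun t => τ (Z * f t) :=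
    fun Z f hf => τ.continuous.comp (continuous_const.mul hf)
  have hc1 : Continuous fun t => τ (Y * fderiv ℝ W (0, t) (0, 1)) :=
    hτc _ (((hWs.continuous_fderiv (by simp)).comp (Continuous.prodMk_right 0)).clm_apply
      continuous_const)
  have hc2 : Continuous fun t => τ (⁅Y, X⁆ * W (0, t)) :=
    hτc _ (hWs.continuous.comp (Continuous.prodMk_right 0))
  -- Maurer–Cartan replaces $\partial_s U$ by $\partial_t W+[X,W]$; the first term is an exact
  -- $t$-derivative, and cyclicity of $\tau$ moves the bracket onto $Y$.
  have hpt : ∀ t, fderiv ℝ F (0, t) (1, 0) =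
      2 * (τ (Y * fderiv ℝ W (0, t) (0, 1)) + τ (⁅Y, X⁆ * W (0, t))) := by
    intro t
    have h1 : τ (Y * (W (0, t) * X)) = τ (X * Y * W (0, t)) := by
      rw [← mul_assoc, hτ, mul_assoc]
    rw [hF', hU, fderiv_leftLogDeriv_comm hC hD hDC hCD, ← hU, ← hW, hX, Ring.lie_def, Ring.lie_def,
      mul_add, mul_sub, sub_mul, map_add, map_sub, map_sub, h1, mul_assoc Y X]
  have h1 : (1 : WithTop ℕ∞) ≤ ∞ := by exact_mod_cast le_top
  have hI := (hasDerivAt_intervalIntegral_of_contDiff (hF.of_le h1)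
    (a := a) (b := b)).const_mul (1 / 2 : ℝ)
  convert! hI using 1
  simp only [hpt]
  rw [intervalIntegral.integral_const_mul,
    intervalIntegral.integral_add (hc1.intervalIntegrable _ _) (hc2.intervalIntegrable _ _),
    intervalIntegral.integral_eq_sub_of_hasDerivAt (fun t _ => hg t) (hc1.intervalIntegrable _ _),
    ha, hb]
  ring

end NormedRing

/-! ### First variation of the energy on W⁶. -/

section FirstVariation

-- The statement uses no norm on matrices; this one is auxiliary, chosen to be submultiplicative.
attribute [local instance] Matrix.linftyOpNormedRing Matrix.linftyOpNormedAlgebra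

/-- The matrix entry at `(i, j)`, as a continuous linear map. -/
noncomputable def entryCLM (i j : Fin 3) : Mat →L[ℝ] ℂ :=
  (Matrix.entryLinearMap ℝ ℂ i j).toContinuousLinearMap

@[simp] theorem entryCLM_apply (i j : Fin 3) (M : Mat) : entryCLM i j M = M i j := rfl

/-- The conjugate transpose, as a continuous linear map over `ℝ`. -/
noncomputable def starCLM : Mat →L[ℝ] Mat :=
  (Matrix.conjTransposeLinearEquiv (Fin 3) (Fin 3) ℝ ℂ).toLinearMap.toContinuousLinearMap

@[simp] theorem starCLM_apply (M : Mat) : starCLM M = M.conjTranspose := rfl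

/-- The projection to `𝔪`, as a continuous linear endomorphism of the matrices. -/
noncomputable def projCLM : Mat →L[ℝ] Mat := (𝔪.subtype ∘ₗ proj).toContinuousLinearMap

@[simp] theorem projCLM_apply (M : Mat) : projCLM M = (proj M : Mat) := rfl

/-- `M ↦ Λ (M_𝔪)`, as a continuous linear endomorphism of the matrices. -/
noncomputable def metricCLM (Λ : 𝔪 →ₗ[ℝ] 𝔪) : Mat →L[ℝ] Mat :=
  (𝔪.subtype ∘ₗ Λ ∘ₗ proj).toContinuousLinearMap

@[simp] theorem metricCLM_apply (Λ : 𝔪 →ₗ[ℝ] 𝔪) (M : Mat) :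
    metricCLM Λ M = (Λ (proj M) : Mat) := rfl

/-- `M ↦ -Re tr M`, as a continuous linear map. -/
noncomputable def negReTrace : Mat →L[ℝ] ℝ :=
  (-(Complex.reLm ∘ₗ Matrix.traceLinearMap (Fin 3) ℝ ℂ)).toContinuousLinearMap

theorem negReTrace_mul (X Y : Mat) : negReTrace (X * Y) = B X Y := rfl

theorem contDiff_matrix {E : Type*} [NormedAddCommGroup E] [NormedSpace ℝ E] {C : E → Mat} :
    ContDiff ℝ ∞ C ↔ ∀ i j, ContDiff ℝ ∞ fun x => C x i j := by
  constructor
  · intro h i j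
    exact (entryCLM i j).contDiff.comp h
  · intro h
    have e : C = fun x => ∑ i, ∑ j, C x i j • Matrix.single i j (1 : ℂ) := by
      funext x
      conv_lhs => rw [Matrix.matrix_eq_sum_single (C x)]
      simp
    rw [e]
    exact ContDiff.sum fun i _ => ContDiff.sum fun j _ => (h i j).smul contDiff_const

theorem smoothToU3_iff {E : Type*} [NormedAddCommGroup E] [NormedSpace ℝ E] {g : E → U3} :
    SmoothToU3 g ↔ ContDiff ℝ ∞ fun x => (g x : Mat) := contDiff_matrix.symm

theorem hasDerivAt_matrix_apply {C : ℝ → Mat} {C' : Mat} {t : ℝ} (h : HasDerivAt C C' t)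
    (i j : Fin 3) : HasDerivAt (fun τ => C τ i j) (C' i j) t :=
  (entryCLM i j).hasFDerivAt.comp_hasDerivAt t h

theorem coe_inv_U3 (g : U3) : ((g⁻¹ : U3) : Mat) = (g : Mat).conjTranspose := rfl

theorem conjTranspose_mul_self (g : U3) : (g : Mat).conjTranspose * (g : Mat) = 1 :=
  Matrix.mem_unitaryGroup_iff'.1 g.2

theorem mul_conjTranspose_self (g : U3) : (g : Mat) * (g : Mat).conjTranspose = 1 :=
  Matrix.mem_unitaryGroup_iff.1 g.2

theorem velocity_eq {g : ℝ → U3} {t : ℝ} {g' : Mat} (h : HasDerivAt (fun τ => (g τ : Mat)) g' t) :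
    velocity g t = proj ((g t : Mat).conjTranspose * g') := by
  rw [velocity, coe_inv_U3]
  congr 2
  ext i j
  exact (hasDerivAt_matrix_apply h i j).deriv

theorem conjTranspose_mul_deriv_mem {g : ℝ → U3} {t : ℝ} {g' : Mat}
    (h : HasDerivAt (fun τ => (g τ : Mat)) g' t) : (g t : Mat).conjTranspose * g' ∈ 𝔤 := by
  have h1 := (starCLM.hasFDerivAt.comp_hasDerivAt t h).mul h
  have h2 : HasDerivAt (fun _ : ℝ => (1 : Mat)) 0 t := hasDerivAt_const t _
  have h3 : (starCLM ∘ fun τ => (g τ : Mat)) * (fun τ => (g τ : Mat)) = fun _ => (1 : Mat) := by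
    funext τ
    exact conjTranspose_mul_self (g τ)
  rw [h3] at h1
  have h4 := h1.unique h2
  rw [mem_𝔤, Matrix.conjTranspose_mul, Matrix.conjTranspose_conjTranspose]
  exact eq_neg_of_add_eq_zero_left h4

theorem contDiff_expCurve (X : 𝔪) : ContDiff ℝ ∞ fun t : ℝ => (expCurve X t : Mat) := by
  have h : ContDiff ℝ ∞ (NormedSpace.exp : Mat → Mat) :=
    contDiff_iff_contDiffAt.2 fun x => (NormedSpace.exp_analytic (𝕂 := ℝ) x).contDiffAt
  exact h.comp (contDiff_id.smul contDiff_const)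

theorem hasDerivAt_expCurve (X : 𝔪) (t : ℝ) :
    HasDerivAt (fun t => (expCurve X t : Mat)) ((expCurve X t : Mat) * X) t :=
  hasDerivAt_exp_smul_const (X : Mat) t

/-- Both parts of $M$ dropped by `proj`, the Hermitian part and the diagonal, are $B$-orthogonal to
$\mathfrak m$. -/
theorem B_proj (Y : 𝔪) (M : Mat) : B (Y : Mat) (proj M : Mat) = B Y M := by
  obtain ⟨hY, hY0⟩ := mem_𝔪_iff.1 Y.2
  have h : ∀ i j, (proj M : Mat) i j = if i = j then 0 else (M i j - star (M j i)) / 2 :=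
    fun _ _ => rfl
  simp only [B, Matrix.trace, Matrix.diag, Matrix.mul_apply, Fin.sum_univ_three, hY0, h]
  rw [apply_apply_of_mem_𝔤 hY 1 0, apply_apply_of_mem_𝔤 hY 2 0, apply_apply_of_mem_𝔤 hY 2 1]
  simp
  ring

variable {c : ℝ × ℝ → U3}

/-- The logarithmic derivative `c⁻¹ ∂_v c` of a map into `U(3)`. -/
noncomputable def logDeriv (c : ℝ × ℝ → U3) (v p : ℝ × ℝ) : Mat :=
  leftLogDeriv (fun q => (c q : Mat)) (fun q => (c q : Mat).conjTranspose) v p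

theorem hasDerivAt_fst (hc : SmoothToU3 c) (s t : ℝ) :
    ∃ C', HasDerivAt (fun σ => (c (σ, t) : Mat)) C' s :=
  ⟨_, hasDerivAt_slice_left ((smoothToU3_iff.1 hc).differentiable (by simp)) s t⟩

theorem hasDerivAt_snd (hc : SmoothToU3 c) (s t : ℝ) :
    ∃ C', HasDerivAt (fun τ => (c (s, τ) : Mat)) C' t :=
  ⟨_, hasDerivAt_slice_right ((smoothToU3_iff.1 hc).differentiable (by simp)) s t⟩

theorem logDeriv_fst (hc : SmoothToU3 c) {s t : ℝ} {C' : Mat}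
    (h : HasDerivAt (fun σ => (c (σ, t) : Mat)) C' s) :
    logDeriv c (1, 0) (s, t) = (c (s, t) : Mat).conjTranspose * C' :=
  leftLogDeriv_fst (smoothToU3_iff.1 hc) h

theorem logDeriv_snd (hc : SmoothToU3 c) {s t : ℝ} {C' : Mat}
    (h : HasDerivAt (fun τ => (c (s, τ) : Mat)) C' t) :
    logDeriv c (0, 1) (s, t) = (c (s, t) : Mat).conjTranspose * C' :=
  leftLogDeriv_snd (smoothToU3_iff.1 hc) h

theorem velocity_slice (hc : SmoothToU3 c) (s t : ℝ) :
    velocity (fun τ => c (s, τ)) t = proj (logDeriv c (0, 1) (s, t)) := by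
  obtain ⟨C', h⟩ := hasDerivAt_snd hc s t
  rw [logDeriv_snd hc h]
  exact velocity_eq h

/-- A fixed endpoint in the quotient means that $c(0,t)^{-1}c(s,t)$ stays in $H$. With
`B_eq_zero_of_isDiag` this removes the boundary terms of the first variation. -/
theorem logDeriv_isDiag (hc : SmoothToU3 c) {t : ℝ}
    (h : ∀ s, (c (s, t) : W6) = (c (0, t) : W6)) : (logDeriv c (1, 0) (0, t)).IsDiag := by
  intro i j hij
  obtain ⟨C', hd⟩ := hasDerivAt_fst hc 0 t
  rw [logDeriv_fst hc hd]
  have h1 := hasDerivAt_matrix_apply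
    (hd.const_mul ((c (0, t) : Mat).conjTranspose)) i j
  have h2 : (fun s => ((c (0, t) : Mat).conjTranspose * (c (s, t) : Mat)) i j) = fun _ => 0 := by
    funext s
    have h3 : (c (0, t))⁻¹ * c (s, t) ∈ H := QuotientGroup.eq.1 (h s).symm
    exact h3 hij
  rw [h2] at h1
  exact h1.unique (hasDerivAt_const 0 0)

theorem B_eq_zero_of_isDiag (Y : 𝔪) {M : Mat} (hM : M.IsDiag) : B (Y : Mat) M = 0 := by
  have hY := (mem_𝔪_iff.1 Y.2).2
  have hz : ((Y : Mat) * M).trace = 0 := by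
    refine Finset.sum_eq_zero fun i _ => ?_
    rw [Matrix.diag_apply, Matrix.mul_apply]
    refine Finset.sum_eq_zero fun k _ => ?_
    by_cases hk : k = i
    · subst hk; rw [hY, zero_mul]
    · rw [hM hk, mul_zero]
  simp [B, hz]

theorem B_comm (X Y : Mat) : B X Y = B Y X := by
  rw [B, B, Matrix.trace_mul_comm]

/-- The first variation of the energy at the curve `t ↦ exp(tX) · o`. -/
theorem hasDerivAt_energy {Λ : 𝔪 →ₗ[ℝ] 𝔪} (hΛ : IsInvariantMetric Λ) {X : 𝔪}
    (hc : SmoothToU3 c) (h0 : ∀ t, c (0, t) = expCurve X t) {a b : ℝ}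
    (ha : ∀ s, (c (s, a) : W6) = (c (0, a) : W6)) (hb : ∀ s, (c (s, b) : W6) = (c (0, b) : W6)) :
    HasDerivAt (fun s => energy Λ (fun t => c (s, t)) a b)
      (∫ t in a..b, B ⁅(Λ X : Mat), (X : Mat)⁆ (logDeriv c (1, 0) (0, t))) 0 := by
  have hE : (fun s => energy Λ (fun t => c (s, t)) a b) =
      fun s => (1 / 2 : ℝ) * ∫ t in a..b, negReTrace
        (metricCLM Λ (logDeriv c (0, 1) (s, t)) * projCLM (logDeriv c (0, 1) (s, t))) := by
    funext s
    simp only [energy, velocity_slice hc]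
    rfl
  have hX : ∀ t, logDeriv c (0, 1) (0, t) = X := by
    intro t
    have h1 : HasDerivAt (fun τ => (c (0, τ) : Mat)) ((expCurve X t : Mat) * X) t := by
      simp only [h0]
      exact hasDerivAt_expCurve X t
    rw [logDeriv_snd hc h1, h0, ← mul_assoc, conjTranspose_mul_self, one_mul]
  have hC := smoothToU3_iff.1 hc
  have hD : ContDiff ℝ ∞ fun q => (c q : Mat).conjTranspose := starCLM.contDiff.comp hC
  have hY : ∀ M : Mat, negReTrace (metricCLM Λ M * projCLM X + metricCLM Λ X * projCLM M) =
      2 * negReTrace ((Λ X : Mat) * M) := by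
    intro M
    have h1 : B (Λ (proj M) : Mat) X = B (Λ X : Mat) M := by
      rw [hΛ.symm, B_comm, B_proj]
    rw [map_add, negReTrace_mul, negReTrace_mul, negReTrace_mul, metricCLM_apply, metricCLM_apply,
      projCLM_apply, projCLM_apply, proj_of_mem_𝔪, B_proj, h1]
    ring
  rw [hE]
  exact hasDerivAt_quadratic_energy hC hD (fun p => conjTranspose_mul_self (c p))
    (fun p => mul_conjTranspose_self (c p)) (metricCLM Λ) projCLM negReTrace
    B_comm hX hY
    (B_eq_zero_of_isDiag (Λ X) (logDeriv_isDiag hc ha))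
    (B_eq_zero_of_isDiag (Λ X) (logDeriv_isDiag hc hb))

end FirstVariation
-- Independence of the lift, and the geodesic criterion.
section Geodesics

attribute [local instance] Matrix.linftyOpNormedRing Matrix.linftyOpNormedAlgebra

theorem coe_Ad (h : H) (X : 𝔪) :
    (Ad h X : Mat) = ((h : U3) : Mat) * (X : Mat) * ((h : U3) : Mat).conjTranspose := rfl

theorem B_Ad (h : H) (X Y : 𝔪) : B (Ad h X : Mat) (Ad h Y) = B X Y := by
  have e : (Ad h X : Mat) * (Ad h Y : Mat) =
      ((h : U3) : Mat) * ((X : Mat) * (Y : Mat)) * ((h : U3) : Mat).conjTranspose := by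
    rw [coe_Ad, coe_Ad]
    simp only [mul_assoc]
    rw [← mul_assoc _ ((h : U3) : Mat), conjTranspose_mul_self, one_mul]
  rw [B, B, e, Matrix.trace_mul_comm, ← mul_assoc, conjTranspose_mul_self, one_mul]

theorem proj_conj (h : H) {M : Mat} (hM : M ∈ 𝔤) :
    proj (((h : U3) : Mat) * M * ((h : U3) : Mat).conjTranspose) = Ad h (proj M) := by
  have hd : ((h : U3) : Mat).IsDiag := h.2
  have hZ := sub_proj_mem_𝔥 hM
  have e : ((h : U3) : Mat) * M * ((h : U3) : Mat).conjTranspose = (Ad h (proj M) : Mat) +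
      ((h : U3) : Mat) * (M - (proj M : Mat)) * ((h : U3) : Mat).conjTranspose := by
    rw [coe_Ad, mul_sub, sub_mul]
    abel
  have hz : ((h : U3) : Mat) * (M - (proj M : Mat)) * ((h : U3) : Mat).conjTranspose ∈ 𝔥 := by
    refine ⟨?_, ?_⟩
    · rw [mem_𝔤, Matrix.conjTranspose_mul, Matrix.conjTranspose_mul,
        Matrix.conjTranspose_conjTranspose, mem_𝔤.1 hZ.1]
      noncomm_ring
    · rw [← hd.diagonal_diag, ← hZ.2.diagonal_diag, Matrix.diagonal_conjTranspose,
        Matrix.diagonal_mul_diagonal, Matrix.diagonal_mul_diagonal]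
      exact Matrix.isDiag_diagonal _
  rw [e, map_add, proj_of_mem_𝔥 hz, proj_of_mem_𝔪, add_zero]

/-- $(gk)^{-1}(gk)'=k^{-1}(g^{-1}g')k+k^{-1}k'$, and the last term lies in $\mathfrak h$, so `proj`
discards it. -/
theorem velocity_mul {g k : ℝ → U3} {t : ℝ} {g' k' : Mat}
    (hg : HasDerivAt (fun τ => (g τ : Mat)) g' t) (hk : HasDerivAt (fun τ => (k τ : Mat)) k' t)
    (hkH : ∀ τ, k τ ∈ H) :
    velocity (fun τ => g τ * k τ) t = Ad ⟨(k t)⁻¹, H.inv_mem (hkH t)⟩ (velocity g t) := by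
  have hk' : k'.IsDiag := by
    intro i j hij
    have h1 := hasDerivAt_matrix_apply hk i j
    have h2 : (fun τ => (k τ : Mat) i j) = fun _ => 0 := funext fun τ => hkH τ hij
    rw [h2] at h1
    exact h1.unique (hasDerivAt_const t 0)
  have hkd : (k t : Mat).IsDiag := hkH t
  have hz : (k t : Mat).conjTranspose * k' ∈ 𝔥 := by
    refine ⟨conjTranspose_mul_deriv_mem hk, ?_⟩
    rw [← hkd.diagonal_diag, ← hk'.diagonal_diag, Matrix.diagonal_conjTranspose,
      Matrix.diagonal_mul_diagonal]
    exact Matrix.isDiag_diagonal _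
  have hd : HasDerivAt (fun τ => ((g τ * k τ : U3) : Mat))
      (g' * (k t : Mat) + (g t : Mat) * k') t := hg.mul hk
  have hconj := proj_conj ⟨(k t)⁻¹, H.inv_mem (hkH t)⟩ (conjTranspose_mul_deriv_mem hg)
  rw [velocity_eq hd, velocity_eq hg, ← hconj]
  have e : ((g t * k t : U3) : Mat).conjTranspose * (g' * (k t : Mat) + (g t : Mat) * k') =
      (k t : Mat).conjTranspose * ((g t : Mat).conjTranspose * g') * (k t : Mat) +
        (k t : Mat).conjTranspose * k' := by
    have h1 : ((g t * k t : U3) : Mat).conjTranspose =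
        (k t : Mat).conjTranspose * (g t : Mat).conjTranspose := Matrix.conjTranspose_mul _ _
    rw [h1, mul_add]
    congr 1
    · simp only [mul_assoc]
    · rw [mul_assoc, ← mul_assoc _ (g t : Mat), conjTranspose_mul_self, one_mul]
  rw [e, map_add, proj_of_mem_𝔥 hz, add_zero]
  simp only [coe_inv_U3, Matrix.conjTranspose_conjTranspose]

/-- The energy of `g · o` does not depend on the lift `g`. -/
theorem IsInvariantMetric.energy_mul {Λ : 𝔪 →ₗ[ℝ] 𝔪} (hΛ : IsInvariantMetric Λ) {g k : ℝ → U3}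
    (hg : Differentiable ℝ fun τ => (g τ : Mat)) (hk : Differentiable ℝ fun τ => (k τ : Mat))
    (hkH : ∀ τ, k τ ∈ H) (a b : ℝ) :
    energy Λ (fun τ => g τ * k τ) a b = energy Λ g a b := by
  rw [energy, energy]
  congr 2
  funext t
  rw [velocity_mul (hg t).hasDerivAt (hk t).hasDerivAt hkH, hΛ.equivariant, B_Ad]

theorem smoothToU3_mul {E : Type*} [NormedAddCommGroup E] [NormedSpace ℝ E] {g k : E → U3}
    (hg : SmoothToU3 g) (hk : SmoothToU3 k) : SmoothToU3 fun x => g x * k x :=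
  smoothToU3_iff.2 ((smoothToU3_iff.1 hg).mul (smoothToU3_iff.1 hk))

theorem smoothToU3_inv {E : Type*} [NormedAddCommGroup E] [NormedSpace ℝ E] {g : E → U3}
    (hg : SmoothToU3 g) : SmoothToU3 fun x => (g x)⁻¹ :=
  smoothToU3_iff.2 (starCLM.contDiff.comp (smoothToU3_iff.1 hg))

theorem smoothToU3_comp {E F : Type*} [NormedAddCommGroup E] [NormedSpace ℝ E]
    [NormedAddCommGroup F] [NormedSpace ℝ F] {g : F → U3} (hg : SmoothToU3 g) {φ : E → F}
    (hφ : ContDiff ℝ ∞ φ) : SmoothToU3 fun x => g (φ x) :=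
  fun i j => (hg i j).comp hφ

theorem smoothToU3_expCurve (X : 𝔪) : SmoothToU3 (expCurve X) :=
  smoothToU3_iff.2 (contDiff_expCurve X)

/-- `t ↦ exp(tX) · o` is a geodesic if `[X, ΛX] = 0`. -/
theorem isGeodesic_of_lie_eq_zero {Λ : 𝔪 →ₗ[ℝ] 𝔪} (hΛ : IsInvariantMetric Λ) {X : 𝔪}
    (hX : ⁅(X : Mat), (Λ X : Mat)⁆ = 0) : IsGeodesic Λ fun t => (expCurve X t : W6) := by
  refine ⟨⟨expCurve X, smoothToU3_expCurve X, fun _ => rfl⟩, ?_⟩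
  intro a b _ c hc h0 hend
  -- An arbitrary lift $c$ agrees with $\exp(tX)$ at $s=0$ only modulo $H$; multiplying by $k(t)\in
  -- H$ corrects it without changing the energy.
  let k : ℝ → U3 := fun t => (c (0, t))⁻¹ * expCurve X t
  have hkH : ∀ t, k t ∈ H := fun t => QuotientGroup.eq.1 (h0 t)
  have hk : SmoothToU3 k := smoothToU3_mul
    (smoothToU3_inv (smoothToU3_comp hc (contDiff_const.prodMk contDiff_id)))
    (smoothToU3_expCurve X)
  let c' : ℝ × ℝ → U3 := fun p => c p * k p.2
  have hc' : SmoothToU3 c' := smoothToU3_mul hc (smoothToU3_comp hk contDiff_snd)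
  have hc'0 : ∀ t, c' (0, t) = expCurve X t := fun t => mul_inv_cancel_left _ _
  have hcoe : ∀ p, (c' p : W6) = c p := fun p => QuotientGroup.mk_mul_of_mem _ (hkH p.2)
  have hd := hasDerivAt_energy hΛ hc' hc'0 (a := a) (b := b)
    (fun s => by rw [hcoe, hcoe, (hend s).1, (hend 0).1])
    (fun s => by rw [hcoe, hcoe, (hend s).2, (hend 0).2])
  have hX' : ⁅(Λ X : Mat), (X : Mat)⁆ = 0 := by
    rw [Ring.lie_def] at hX ⊢
    rw [← neg_sub, hX, neg_zero]
  rw [hX'] at hd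
  have hE : (fun s => energy Λ (fun t => c (s, t)) a b) =
      fun s => energy Λ (fun t => c' (s, t)) a b := by
    funext s
    refine (hΛ.energy_mul (g := fun t => c (s, t)) (k := k) ?_ ?_ hkH a b).symm
    · exact (smoothToU3_iff.1 (smoothToU3_comp hc
        (contDiff_const.prodMk contDiff_id))).differentiable (by simp)
    · exact (smoothToU3_iff.1 hk).differentiable (by simp)
  rw [hE]
  simpa [B] using hd

/-- If `t ↦ exp(tX) · o` is a geodesic, then `[X, ΛX]_𝔪 = 0`. -/
theorem IsGeodesic.proj_lie_eq_zero {Λ : 𝔪 →ₗ[ℝ] 𝔪} (hΛ : IsInvariantMetric Λ) {X : 𝔪}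
    (hX : IsGeodesic Λ fun t => (expCurve X t : W6)) : proj ⁅(X : Mat), (Λ X : Mat)⁆ = 0 := by
  set Y : 𝔪 := proj ⁅(Λ X : Mat), (X : Mat)⁆ with hY
  -- The factor $t(1-t)$ fixes the endpoints of $[0,1]$. The variation field is $t(1-t)Y$, so the
  -- derivative of the energy is $\tfrac16B(Y,Y)$, which vanishes only for $Y=0$.
  let c : ℝ × ℝ → U3 := fun p => expCurve X p.2 * expCurve Y (p.1 * (p.2 * (1 - p.2)))
  have hexp0 : expCurve Y 0 = 1 := Subtype.ext (by simp [expCurve])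
  have hc : SmoothToU3 c := smoothToU3_mul (smoothToU3_comp (smoothToU3_expCurve X) contDiff_snd)
    (smoothToU3_comp (smoothToU3_expCurve Y) (by fun_prop))
  have hc0 : ∀ t, c (0, t) = expCurve X t := fun t => by simp [c, hexp0]
  have ha : ∀ s, c (s, 0) = expCurve X 0 := fun s => by simp [c, hexp0]
  have hb : ∀ s, c (s, 1) = expCurve X 1 := fun s => by simp [c, hexp0]
  have h1 := hX.2 0 1 one_pos c hc (fun t => by rw [hc0])
    (fun s => by rw [ha, hb]; exact ⟨rfl, rfl⟩)
  have h2 := hasDerivAt_energy hΛ hc hc0 (a := 0) (b := 1)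
    (fun s => by rw [ha, ha]) (fun s => by rw [hb, hb])
  have hW : ∀ t, logDeriv c (1, 0) (0, t) = (t * (1 - t)) • (Y : Mat) := by
    intro t
    have hφ : HasDerivAt (fun s : ℝ => s * (t * (1 - t))) (t * (1 - t)) 0 := by
      simpa using (hasDerivAt_id (0 : ℝ)).mul_const (t * (1 - t))
    have hY0 := hasDerivAt_expCurve Y (0 * (t * (1 - t)))
    have h3 := (hY0.scomp 0 hφ).const_mul (expCurve X t : Mat)
    rw [logDeriv_fst hc h3, hc0, ← mul_assoc, conjTranspose_mul_self, one_mul, zero_mul, hexp0]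
    simp
  have h3 := h2.unique h1
  have hB : ∀ t : ℝ, B ⁅(Λ X : Mat), (X : Mat)⁆ (logDeriv c (1, 0) (0, t)) =
      t * (1 - t) * B (Y : Mat) Y := by
    intro t
    have h4 : B (Y : Mat) ⁅(Λ X : Mat), (X : Mat)⁆ = B (Y : Mat) Y := (B_proj Y _).symm
    rw [hW, B_comm, ← h4]
    simp [B]
  simp only [hB, intervalIntegral.integral_mul_const] at h3
  have h4 : ∫ t in (0 : ℝ)..1, t * (1 - t) = 1 / 6 := by
    have : ∀ t : ℝ, t * (1 - t) = t - t ^ 2 := fun t => by ring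
    simp only [this]
    rw [intervalIntegral.integral_sub (by simp) (by simp)]
    norm_num [integral_id, integral_pow]
  rw [h4] at h3
  have h5 : Y = 0 := eq_zero_of_B_self_eq_zero (by linarith)
  have h6 : ⁅(X : Mat), (Λ X : Mat)⁆ = -⁅(Λ X : Mat), (X : Mat)⁆ := by
    rw [Ring.lie_def, Ring.lie_def, neg_sub]
  rw [h6, map_neg, ← hY, h5, neg_zero]

theorem isEquigeodesicVector_iff (X : 𝔪) : IsEquigeodesicVector X ↔ IsTrivial X :=
  ⟨fun h => isTrivial_of_proj_lie_weightOp_eq_zero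
    ((h _ isInvariantMetric_weightOp).proj_lie_eq_zero isInvariantMetric_weightOp),
  fun h _ hΛ => isGeodesic_of_lie_eq_zero hΛ (hΛ.lie_eq_zero h)⟩

end Geodesics

/-! ### The six equations and the main theorem. -/

theorem forall_proj_lie_eq_zero_iff (X : 𝔪) :
    (∀ Λ : 𝔪 →ₗ[ℝ] 𝔪, IsInvariantMetric Λ → proj ⁅(X : Mat), (Λ X : Mat)⁆ = 0) ↔ IsTrivial X :=
  ⟨fun h => isTrivial_of_proj_lie_weightOp_eq_zero (h _ isInvariantMetric_weightOp),
  fun h Λ hΛ => by rw [hΛ.lie_eq_zero h, map_zero]⟩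

theorem equations_iff_isTrivial (a₁₂ b₁₂ a₁₃ b₁₃ a₂₃ b₂₃ : ℝ) (X : 𝔪)
    (hX : (X : Mat) = (a₁₂ • e 0 1 + b₁₂ • f 0 1) + (a₁₃ • e 0 2 + b₁₃ • f 0 2)
        + (a₂₃ • e 1 2 + b₂₃ • f 1 2)) :
    (b₁₂ * b₁₃ + a₁₂ * a₁₃ = 0 ∧ b₁₂ * a₁₃ - a₁₂ * b₁₃ = 0 ∧
         a₁₂ * a₂₃ - b₁₂ * b₂₃ = 0 ∧ a₁₂ * b₂₃ + b₁₂ * a₂₃ = 0 ∧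
         a₁₃ * a₂₃ + b₁₃ * b₂₃ = 0 ∧ a₁₃ * b₂₃ - b₁₃ * a₂₃ = 0) ↔ IsTrivial X := by
  have h01 : (X : Mat) 0 1 = ⟨a₁₂, b₁₂⟩ := by
    rw [hX]; simp [e, f, Matrix.single, Complex.ext_iff]
  have h02 : (X : Mat) 0 2 = ⟨a₁₃, b₁₃⟩ := by
    rw [hX]; simp [e, f, Matrix.single, Complex.ext_iff]
  have h12 : (X : Mat) 1 2 = ⟨a₂₃, b₂₃⟩ := by
    rw [hX]; simp [e, f, Matrix.single, Complex.ext_iff]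
  -- Conjugating one factor does not affect vanishing, but gives the signs that appear in the stated
  -- equations.
  have h3 : (X : Mat) 0 1 * (X : Mat) 0 2 = 0 ↔ star ((X : Mat) 0 1) * (X : Mat) 0 2 = 0 := by
    simp only [mul_eq_zero, star_eq_zero]
  have h4 : (X : Mat) 0 2 * (X : Mat) 1 2 = 0 ↔ star ((X : Mat) 0 2) * (X : Mat) 1 2 = 0 := by
    simp only [mul_eq_zero, star_eq_zero]
  rw [isTrivial_iff, h3, h4, h01, h02, h12]
  simp only [Complex.ext_iff, Complex.mul_re, Complex.mul_im, RCLike.star_def, Complex.conj_re,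
    Complex.conj_im, Complex.zero_re, Complex.zero_im]
  constructor
  · rintro ⟨h1, h2, h3, h4, h5, h6⟩
    refine ⟨⟨?_, ?_⟩, ⟨?_, ?_⟩, ?_, ?_⟩ <;> linarith
  · rintro ⟨⟨h1, h2⟩, ⟨h3, h4⟩, h5, h6⟩
    refine ⟨?_, ?_, ?_, ?_, ?_, ?_⟩ <;> linarith

end WallachW6

theorem mainTheorem1 :
    (∀ (a₁₂ b₁₂ a₁₃ b₁₃ a₂₃ b₂₃ : ℝ) (X : 𝔪),
      (X : Mat) = (a₁₂ • e 0 1 + b₁₂ • f 0 1) + (a₁₃ • e 0 2 + b₁₃ • f 0 2)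
        + (a₂₃ • e 1 2 + b₂₃ • f 1 2) →
      ((∀ Λ : 𝔪 →ₗ[ℝ] 𝔪, IsInvariantMetric Λ → proj ⁅(X : Mat), (Λ X : Mat)⁆ = 0) ↔
        (b₁₂ * b₁₃ + a₁₂ * a₁₃ = 0 ∧ b₁₂ * a₁₃ - a₁₂ * b₁₃ = 0 ∧
         a₁₂ * a₂₃ - b₁₂ * b₂₃ = 0 ∧ a₁₂ * b₂₃ + b₁₂ * a₂₃ = 0 ∧
         a₁₃ * a₂₃ + b₁₃ * b₂₃ = 0 ∧ a₁₃ * b₂₃ - b₁₃ * a₂₃ = 0)) ∧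
      ((b₁₂ * b₁₃ + a₁₂ * a₁₃ = 0 ∧ b₁₂ * a₁₃ - a₁₂ * b₁₃ = 0 ∧
         a₁₂ * a₂₃ - b₁₂ * b₂₃ = 0 ∧ a₁₂ * b₂₃ + b₁₂ * a₂₃ = 0 ∧
         a₁₃ * a₂₃ + b₁₃ * b₂₃ = 0 ∧ a₁₃ * b₂₃ - b₁₃ * a₂₃ = 0) ↔ IsTrivial X)) ∧
    (∀ X : 𝔪, IsEquigeodesicVector X ↔ IsTrivial X) := by
  exact ⟨fun a₁₂ b₁₂ a₁₃ b₁₃ a₂₃ b₂₃ X hX =>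
    ⟨(forall_proj_lie_eq_zero_iff X).trans (equations_iff_isTrivial _ _ _ _ _ _ X hX).symm,
      equations_iff_isTrivial _ _ _ _ _ _ X hX⟩, isEquigeodesicVector_iff⟩
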